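/- **Setting.** Consider uncapacitated facility location with a finite set $C$ of clients, a finite set $F$ of facilities, a (pseudo)metric $dist$ on $F\cup C$, and uniform opening cost $\lambda\ge 0$. A solution is a nonempty set $S\subseteq F$; its connection cost is $d(S)=\sum_{c\in C}dist(c,S)$, where $dist(c,S)=\min_{f\in S}dist(c,f)$, and its total cost is $\lambda|S|+d(S)$. Each client $c$ is served in $S$ by a closest facility $S(c)\in S$ (ties are broken arbitrarily), and $C_S(A)=\{c\in C: S(c)\in A\}$ is the set of clients served by $A\subseteq S$. Let $\varepsilon>0$ and $\Delta=2\varepsilon^{-2\varepsilon^{-7}}$. Let $S'$ be a local optimum: for all $A\subseteq S'$ and $B\subseteq F$ with $|A|,|B|\le\Delta$ such that $(S'\setminus A)\cup B$ is a solution, the total cost of $(S'\setminus A)\cup B$ is at least that of $S'$. Let $OPT$ be any solution. Write $k'=|S'|$, $d'=d(S')$, $k=|OPT|$, $opt=d(OPT)$. **Matched and lonely facilities.** For solutions $S,T$, a set $A\subseteq S$ (or a single facility, identified with a singleton) *$\alpha$-captures* $g\in T$ if $|C_S(A)\cap C_T(\{g\})|>\alpha\,|C_T(\{g\})|$. Let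 $0\le\delta\le 1/2$. * If $k'\le k$: for $f^*\in OPT$ let $M(f^*)$ be the set of facilities of $S'$ that are $\tfrac12$-captured by $f^*$. If $M(f^*)$ $(1-\delta)$-captures $f^*$, then $f^*$ and all facilities in $M(f^*)$ are matched. * If $k'>k$: for $f'\in S'$ let $M(f')$ be the set of facilities of $OPT$ that are $(1-\delta)$-captured by $f'$. If $M(f')$ $\tfrac12$-captures $f'$, then $f'$ and all facilities in $M(f')$ are matched. All other facilities are lonely. Let $opt^{M}$ (resp. $opt^{L}$) be the connection cost in $OPT$ of the clients served in $OPT$ by matched (resp. lonely) facilities of $OPT$. Let $opt^{MM}$ and $d^{MM}$ be the connection costs, in $OPT$ and in $S'$ respectively, of the clients that are served by a matched facility of $S'$ in $S'$ and by a matched facility of $OPT$ in $OPT$. **Theorem.** There is an absolute constant $K>0$ (independent of the instance, $\lambda$, $\varepsilon$, $\delta$, $S'$ and $OPT$) such that in this setting $$\lambda k'+d'\;\le\;\lambda k+3\,opt^{L}+opt^{M}+\frac{\delta}{1-\delta}\bigl(d^{MM}+opt^{MM}\bigr)+K\,\varepsilon\,(d'+opt).$$ -/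

import Mathlib

namespace UFL

variable {X : Type*} [PseudoMetricSpace X] [DecidableEq X]

/-- Connection cost `d(S) = ∑_{j ∈ C} dist(j, S)`. For a nonempty finite `S`, `Metric.infDist j S`
is the minimum of `dist j f` over `f ∈ S`. -/
noncomputable def connCost (C S : Finset X) : ℝ :=
  ∑ j ∈ C, Metric.infDist j (S : Set X)

/-- Total cost of the solution `S` with uniform opening cost `lam`. -/
noncomputable def totalCost (lam : ℝ) (C S : Finset X) : ℝ :=
  lam * (S.card : ℝ) + connCost C S

/-- A feasible solution: a nonempty set of open facilities (so that clients can be connected). -/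
def IsSolution (F S : Finset X) : Prop :=
  S ⊆ F ∧ S.Nonempty

/-- `S` is a local optimum for swaps `S ↦ (S \ A) ∪ B` with `A ⊆ S`, `B ⊆ F`, `|A|, |B| ≤ D`:
no such swap yields a feasible solution of strictly smaller total cost. -/
def IsLocalOptimum (lam D : ℝ) (C F S : Finset X) : Prop :=
  IsSolution F S ∧
    ∀ A B : Finset X, A ⊆ S → B ⊆ F → (A.card : ℝ) ≤ D → (B.card : ℝ) ≤ D →
      IsSolution F ((S \ A) ∪ B) → totalCost lam C S ≤ totalCost lam C ((S \ A) ∪ B)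

/-- `s j` is the facility serving client `j` in the solution `S`: a closest open facility
(ties broken in an arbitrary fixed way). -/
def IsServing (C S : Finset X) (s : X → X) : Prop :=
  ∀ j ∈ C, s j ∈ S ∧ dist j (s j) = Metric.infDist j (S : Set X)

/-- The clients served by the facilities in `A`, if clients are served according to `s`. -/
def clientsOf (C : Finset X) (s : X → X) (A : Finset X) : Finset X :=
  C.filter fun j => s j ∈ A

/-- `A` (in the solution with serving map `s`) `α`-captures the facility `g` (of the solution with
serving map `t`): more than an `α` fraction of the clients served by `g` are served by `A`. -/
def Captures (C : Finset X) (α : ℝ) (s : X → X) (A : Finset X) (t : X → X) (g : X) : Prop :=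
  α * ((clientsOf C t {g}).card : ℝ) < ((clientsOf C s A ∩ clientsOf C t {g}).card : ℝ)

open Classical in
/-- `M(f)`: the facilities in `T` (serving map `t`) which are `α`-captured by the facility `f`
(of a solution with serving map `s`). -/
noncomputable def capturedBy (C : Finset X) (α : ℝ) (s : X → X) (t : X → X) (T : Finset X)
    (f : X) : Finset X :=
  T.filter fun g => Captures C α s {f} t g

open Classical in
/-- The facilities `f ∈ S` which are matched with `M(f) ⊆ T`, where `M(f)` are the facilities
`α`-captured by `f`: those for which `M(f)` in turn `β`-captures `f`. -/
noncomputable def matchedHeads (C : Finset X) (α β : ℝ) (s : X → X) (S : Finset X)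
    (t : X → X) (T : Finset X) : Finset X :=
  S.filter fun f => Captures C β t (capturedBy C α s t T f) s f

/-- The facilities in `T` which belong to `M(f)` for some `f ∈ S` matched with `M(f)`. -/
noncomputable def matchedTails (C : Finset X) (α β : ℝ) (s : X → X) (S : Finset X)
    (t : X → X) (T : Finset X) : Finset X :=
  (matchedHeads C α β s S t T).biUnion fun f => capturedBy C α s t T f

/-- The matched facilities of `OPT`, where `S'` is served by `s` and `OPT` by `o`. If `|S'| ≤ |OPT|`
then `f* ∈ OPT` is matched with the set `M(f*) ⊆ S'` that it `1/2`-captures, provided `M(f*)`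
`(1-δ)`-captures `f*`. Otherwise `f' ∈ S'` is matched with the set `M(f') ⊆ OPT` that it
`(1-δ)`-captures, provided `M(f')` `1/2`-captures `f'`. -/
noncomputable def optMatched (C : Finset X) (δ : ℝ) (S' : Finset X) (s : X → X)
    (OPT : Finset X) (o : X → X) : Finset X :=
  if S'.card ≤ OPT.card then matchedHeads C (1 / 2) (1 - δ) o OPT s S'
  else matchedTails C (1 - δ) (1 / 2) s S' o OPT

/-- The matched facilities of `S'`, for the same matching as in `optMatched`. -/
noncomputable def solMatched (C : Finset X) (δ : ℝ) (S' : Finset X) (s : X → X)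
    (OPT : Finset X) (o : X → X) : Finset X :=
  if S'.card ≤ OPT.card then matchedTails C (1 / 2) (1 - δ) o OPT s S'
  else matchedHeads C (1 - δ) (1 / 2) s S' o OPT

/-- The lonely facilities of `OPT`. -/
noncomputable def optLonely (C : Finset X) (δ : ℝ) (S' : Finset X) (s : X → X)
    (OPT : Finset X) (o : X → X) : Finset X :=
  OPT \ optMatched C δ S' s OPT o

end UFL

/-! Local optimality is summed over swaps that close each facility of `S'` at most once. Every f in
`OPT` gets a home set `H f` in `S'` with a representative `h f`. A lonely f has its nearest facility
of `S'` as its only home. A matched f has M(f) as home set, with `h f` its member nearest to f, or,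
when k' > k, a single f' that captures it. A swap may touch `H f` only if it opens f, so a client c
whose facility closes while `o c` stays shut can move to `h (o c)`. For lonely `o c` this move adds
at most 2 dist(c, `o c`) to the current cost, whence 3 opt^L. For matched `o c`, the clients served
inside `H (o c)` never make the move. The others are at most δ/(1-δ) times as many, and their
detours are charged to the captured ones (`Captures.sum_reroute_le`).

Two obstacles to bounded swaps are removed in `cost_le_of_homes`, with m about 1/ε. A large M(f) is
closed in chunks of at most m, each opening f again; since merging a chunk into f is itself an
admissible swap, the surplus copies of f cost O(1/m)(d' + opt) (`mul_chunk_count_le`). A facility g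
that is the home of more than m unmatched-head facilities is never closed. Those facilities are
either all left unopened, if the opening cost saved pays for the lost gain, or opened one by one; in
the latter case the opening cost of g is at most 1/m of the cost of their clients in `S'`.

Swaps of size 1 + m² therefore suffice, far below Δ. For ε ≥ 1/2 it is enough to treat every
facility as lonely and take m = 1. -/

namespace UFL

section LocalSearch

set_option linter.unusedSectionVars false

variable {X : Type*} [PseudoMetricSpace X] [DecidableEq X]

/-! ### Summing local optimality over a family of swaps. -/

/-- Local optimality for a single swap, in terms of the changes of the connection costs. -/
lemma IsLocalOptimum.swap_le {lam D : ℝ} {C F S A B : Finset X} (hlam : 0 ≤ lam)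
    (h : IsLocalOptimum lam D C F S) (hA : A ⊆ S) (hB : B ⊆ F) (hAD : (A.card : ℝ) ≤ D)
    (hBD : (B.card : ℝ) ≤ D) (hne : ((S \ A) ∪ B).Nonempty) :
    lam * A.card - lam * B.card ≤
      ∑ c ∈ C, (Metric.infDist c (((S \ A) ∪ B : Finset X) : Set X)
        - Metric.infDist c (S : Set X)) := by
  have h1 := h.2 A B hA hB hAD hBD
    ⟨Finset.union_subset (Finset.sdiff_subset.trans h.1.1) hB, hne⟩
  have hcard : (((S \ A) ∪ B).card : ℝ) ≤ S.card - A.card + B.card := by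
    have h2 := Finset.card_union_le (S \ A) B
    have h3 := Finset.card_sdiff_add_card_eq_card hA
    have h4 : (((S \ A) ∪ B).card : ℝ) ≤ (S \ A).card + B.card := by exact_mod_cast h2
    have h5 : ((S \ A).card : ℝ) + A.card = S.card := by exact_mod_cast h3
    linarith
  have h6 := mul_le_mul_of_nonneg_left hcard hlam
  unfold totalCost connCost at h1
  rw [Finset.sum_sub_distrib]
  linarith

lemma sum_le_of_nonpos_off {ι : Type*} {I : Finset ι} {j : ι} {g : ι → ℝ} (hj : j ∈ I)
    (h : ∀ i ∈ I, i ≠ j → g i ≤ 0) : ∑ i ∈ I, g i ≤ g j := by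
  classical
  rw [← Finset.add_sum_erase I g hj]
  have : ∑ i ∈ I.erase j, g i ≤ 0 := Finset.sum_nonpos fun i hi =>
    h i (Finset.mem_of_mem_erase hi) (Finset.ne_of_mem_erase hi)
  linarith

lemma sum_le_of_nonpos_off_pair {ι : Type*} {I : Finset ι} {j k : ι} {g : ι → ℝ} (hj : j ∈ I)
    (hk : k ∈ I) (hkj : k ≠ j) (h : ∀ i ∈ I, i ≠ j → g i ≤ 0) :
    ∑ i ∈ I, g i ≤ g j + g k := by
  classical
  rw [← Finset.add_sum_erase I g hj]
  have : ∑ i ∈ I.erase j, g i ≤ g k :=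
    sum_le_of_nonpos_off (Finset.mem_erase.2 ⟨hkj, hk⟩) fun i hi _ =>
      h i (Finset.mem_of_mem_erase hi) (Finset.ne_of_mem_erase hi)
  linarith

lemma infDist_le_of_mem {Y : Type*} [PseudoMetricSpace Y] {S : Finset Y} {x y : Y} (h : y ∈ S) :
    Metric.infDist x (S : Set Y) ≤ dist x y :=
  Metric.infDist_le_dist_of_mem (by exact_mod_cast h)

/-- Total change of the connection cost of one client under a family of swaps which close each
facility at most once. Here `H f` are the facilities which may only be closed when `f` is opened,
and `h f ∈ H f` is the facility to which the clients of `f` are rerouted. -/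
lemma sum_infDist_change_le {ι : Type*} {I : Finset ι} {A B : ι → Finset X}
    {C S O : Finset X} {s o h : X → X} {H : X → Finset X} {e : ℝ} {c : X} (hc : c ∈ C)
    (hs : IsServing C S s) (ho : IsServing C O o)
    (hdisj : ∀ i ∈ I, ∀ j ∈ I, i ≠ j → Disjoint (A i) (A j))
    (hhH : ∀ f ∈ O, h f ∈ H f) (hHS : ∀ f ∈ O, H f ⊆ S)
    (hvalid : ∀ i ∈ I, ∀ f ∈ O, f ∉ B i → Disjoint (H f) (A i)) (he : 0 ≤ e)
    (hreroute : s c ∉ H (o c) → dist c (h (o c)) ≤ dist c (s c) + e ∨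
      dist c (h (o c)) ≤ dist c (o c) + e) :
    ∑ i ∈ I, (Metric.infDist c (((S \ A i) ∪ B i : Finset X) : Set X)
        - Metric.infDist c (S : Set X)) ≤
      dist c (o c) - dist c (s c) + e
        + (if ∃ i ∈ I, o c ∈ B i then 0 else dist c (s c)) := by
  rw [← (hs c hc).2]
  have hoc := (ho c hc).1
  have hsc := (hs c hc).1
  have ho0 : 0 ≤ dist c (o c) := dist_nonneg
  have hopen : ∀ i ∈ I, o c ∈ B i →
      Metric.infDist c (((S \ A i) ∪ B i : Finset X) : Set X) - dist c (s c)
        ≤ dist c (o c) - dist c (s c) := fun i _ hi =>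
    sub_le_sub_right (infDist_le_of_mem (Finset.mem_union_right _ hi)) _
  have hkeep : ∀ i ∈ I, s c ∉ A i →
      Metric.infDist c (((S \ A i) ∪ B i : Finset X) : Set X) - dist c (s c) ≤ 0 := fun i _ hi =>
    sub_nonpos.2 (infDist_le_of_mem (Finset.mem_union_left _ (Finset.mem_sdiff.2 ⟨hsc, hi⟩)))
  by_cases hcl : ∃ j ∈ I, s c ∈ A j
  -- The swap `j` is the only one closing `s c`, so no other swap can hurt this client.
  · obtain ⟨j, hj, hsj⟩ := hcl
    have hoff : ∀ i ∈ I, i ≠ j →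
        Metric.infDist c (((S \ A i) ∪ B i : Finset X) : Set X) - dist c (s c) ≤ 0 :=
      fun i hi hij => hkeep i hi fun hsi =>
        Finset.disjoint_left.1 (hdisj i hi j hj hij) hsi hsj
    have hsum := sum_le_of_nonpos_off hj hoff
    by_cases hoj : o c ∈ B j
    · rw [if_pos ⟨j, hj, hoj⟩]
      linarith [hopen j hj hoj]
    · have hd := hvalid j hj _ hoc hoj
      have hsH : s c ∉ H (o c) := fun hmem => Finset.disjoint_left.1 hd hmem hsj
      have hh : Metric.infDist c (((S \ A j) ∪ B j : Finset X) : Set X) ≤ dist c (h (o c)) :=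
        infDist_le_of_mem (Finset.mem_union_left _ (Finset.mem_sdiff.2
          ⟨hHS _ hoc (hhH _ hoc), Finset.disjoint_left.1 hd (hhH _ hoc)⟩))
      have hs0 : 0 ≤ dist c (s c) := dist_nonneg
      -- Under the first alternative the loss in `j` is only `e`, and the gain comes from another
      -- swap `k` opening `o c`; without such a swap the final summand `dist c (s c)` compensates.
      -- Under the second, swap `j` alone gives the bound.
      rcases hreroute hsH with h1 | h1
      · split_ifs with hex
        · obtain ⟨k, hk, hok⟩ := hex
          have hkj : k ≠ j := fun hkj => hoj (hkj ▸ hok)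
          have := sum_le_of_nonpos_off_pair hj hk hkj hoff
          linarith [hopen k hk hok]
        · linarith
      · split_ifs <;> linarith
  · push Not at hcl
    have hall : ∀ i ∈ I,
        Metric.infDist c (((S \ A i) ∪ B i : Finset X) : Set X) - dist c (s c) ≤ 0 :=
      fun i hi => hkeep i hi (hcl i hi)
    split_ifs with hex
    · obtain ⟨k, hk, hok⟩ := hex
      have := sum_le_of_nonpos_off hk fun i hi _ => hall i hi
      linarith [hopen k hk hok]
    · linarith [Finset.sum_nonpos hall]

/-- Sum of the local optimality conditions over a family of swaps. -/
lemma sum_swap_le {ι : Type*} {I : Finset ι} {A B : ι → Finset X}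
    {lam D : ℝ} {C F S O : Finset X} {s o h : X → X} {H : X → Finset X} {e : X → ℝ}
    (hlam : 0 ≤ lam) (hS : IsLocalOptimum lam D C F S) (hO : IsSolution F O)
    (hs : IsServing C S s) (ho : IsServing C O o)
    (hAS : ∀ i ∈ I, A i ⊆ S) (hBO : ∀ i ∈ I, B i ⊆ O)
    (hAD : ∀ i ∈ I, ((A i).card : ℝ) ≤ D) (hBD : ∀ i ∈ I, ((B i).card : ℝ) ≤ D)
    (hdisj : ∀ i ∈ I, ∀ j ∈ I, i ≠ j → Disjoint (A i) (A j))
    (hhH : ∀ f ∈ O, h f ∈ H f) (hHS : ∀ f ∈ O, H f ⊆ S)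
    (hvalid : ∀ i ∈ I, ∀ f ∈ O, f ∉ B i → Disjoint (H f) (A i))
    (he : ∀ c ∈ C, 0 ≤ e c)
    (hreroute : ∀ c ∈ C, s c ∉ H (o c) → dist c (h (o c)) ≤ dist c (s c) + e c ∨
      dist c (h (o c)) ≤ dist c (o c) + e c) :
    lam * ∑ i ∈ I, ((A i).card : ℝ) - lam * ∑ i ∈ I, ((B i).card : ℝ) ≤
      ∑ c ∈ C, (dist c (o c) - dist c (s c) + e c
        + (if ∃ i ∈ I, o c ∈ B i then 0 else dist c (s c))) := by
  have hne : ∀ i ∈ I, ((S \ A i) ∪ B i).Nonempty := by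
    intro i hi
    obtain ⟨f, hf⟩ := hO.2
    by_cases hfB : f ∈ B i
    · exact ⟨f, Finset.mem_union_right _ hfB⟩
    · exact ⟨h f, Finset.mem_union_left _ (Finset.mem_sdiff.2 ⟨hHS f hf (hhH f hf),
        Finset.disjoint_left.1 (hvalid i hi f hf hfB) (hhH f hf)⟩)⟩
  calc lam * ∑ i ∈ I, ((A i).card : ℝ) - lam * ∑ i ∈ I, ((B i).card : ℝ)
      = ∑ i ∈ I, (lam * (A i).card - lam * (B i).card) := by
        rw [Finset.sum_sub_distrib, Finset.mul_sum, Finset.mul_sum]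
    _ ≤ ∑ i ∈ I, ∑ c ∈ C, (Metric.infDist c (((S \ A i) ∪ B i : Finset X) : Set X)
          - Metric.infDist c (S : Set X)) :=
        Finset.sum_le_sum fun i hi => hS.swap_le hlam (hAS i hi) ((hBO i hi).trans hO.1)
          (hAD i hi) (hBD i hi) (hne i hi)
    _ = ∑ c ∈ C, ∑ i ∈ I, (Metric.infDist c (((S \ A i) ∪ B i : Finset X) : Set X)
          - Metric.infDist c (S : Set X)) := Finset.sum_comm
    _ ≤ _ := Finset.sum_le_sum fun c hc =>
        sum_infDist_change_le hc hs ho hdisj hhH hHS hvalid (he c hc) (hreroute c hc)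

/-! ### Closing captured facilities in chunks. -/

/-- A finite set can be coloured with `|A| / m + 1` colours, each used at most `m` times. -/
lemma exists_chunk_coloring {Y : Type*} (A : Finset Y) {m : ℕ} (hm : 0 < m) :
    ∃ κ : Y → ℕ, (∀ x ∈ A, κ x < A.card / m + 1) ∧
      ∀ i, (A.filter fun x => κ x = i).card ≤ m := by
  classical
  let g : Y → ℕ := fun x => if hx : x ∈ A then (A.equivFin ⟨x, hx⟩ : ℕ) else 0
  have hg : ∀ x ∈ A, g x < A.card := fun x hx => by
    simp only [g, dif_pos hx]
    exact (A.equivFin ⟨x, hx⟩).2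
  have hinj : Set.InjOn g A := by
    intro x hx y hy hxy
    have hx' : x ∈ A := hx
    have hy' : y ∈ A := hy
    simp only [g, dif_pos hx', dif_pos hy'] at hxy
    simpa using A.equivFin.injective (Fin.ext hxy)
  refine ⟨fun x => g x / m, fun x hx =>
    Nat.lt_succ_of_le (Nat.div_le_div_right (hg x hx).le), fun i => ?_⟩
  have hsub : (A.filter fun x => g x / m = i).image g ⊆ Finset.Ico (i * m) (i * m + m) := by
    intro y hy
    obtain ⟨x, hx, rfl⟩ := Finset.mem_image.1 hy
    have h1 := (Finset.mem_filter.1 hx).2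
    have h2 := Nat.div_add_mod (g x) m
    have h3 := Nat.mod_lt (g x) hm
    rw [h1, mul_comm] at h2
    rw [Finset.mem_Ico]
    omega
  have h1 := Finset.card_le_card hsub
  rw [Finset.card_image_of_injOn (hinj.mono fun x hx =>
    (Finset.mem_filter.1 (Finset.mem_coe.1 hx)).1)] at h1
  simpa using h1

/-- Closing facilities whose clients are close to a facility `f` cannot save much. -/
lemma mul_card_le_of_captured {lam D : ℝ} {C F S A : Finset X} {s o : X → X} {f : X}
    (hlam : 0 ≤ lam) (hS : IsLocalOptimum lam D C F S) (hs : IsServing C S s) (hf : f ∈ F)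
    (hA : A ⊆ S) (hAD : (A.card : ℝ) ≤ D) (hD : 1 ≤ D)
    (hcap : ∀ g ∈ A, ∑ c ∈ C with s c = g, dist g f ≤
      2 * ∑ c ∈ C with s c = g, (dist c (s c) + dist c (o c))) :
    lam * A.card ≤ lam + 2 * ∑ c ∈ C with s c ∈ A, (dist c (s c) + dist c (o c)) := by
  have h1 := hS.swap_le hlam hA (Finset.singleton_subset_iff.2 hf) hAD (by simpa using hD)
    ⟨f, by simp⟩
  have h2 : ∑ c ∈ C, (Metric.infDist c (((S \ A) ∪ {f} : Finset X) : Set X)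
        - Metric.infDist c (S : Set X)) ≤ ∑ c ∈ C with s c ∈ A, dist (s c) f := by
    rw [Finset.sum_filter]
    refine Finset.sum_le_sum fun c hc => ?_
    rw [← (hs c hc).2]
    split_ifs with hcA
    · have h3 : Metric.infDist c (((S \ A) ∪ {f} : Finset X) : Set X) ≤ dist c f :=
        infDist_le_of_mem (by simp)
      linarith [dist_triangle c (s c) f]
    · exact sub_nonpos.2 (infDist_le_of_mem
        (Finset.mem_union_left _ (Finset.mem_sdiff.2 ⟨(hs c hc).1, hcA⟩)))
  have hfib : ∀ w : X → ℝ, ∑ c ∈ C with s c ∈ A, w c =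
      ∑ g ∈ A, ∑ c ∈ C with s c = g, w c := by
    intro w
    rw [Finset.sum_filter]
    simp_rw [Finset.sum_filter]
    rw [Finset.sum_comm]
    exact Finset.sum_congr rfl fun c _ => (Finset.sum_ite_eq A (s c) fun _ => w c).symm
  have h4 : ∑ c ∈ C with s c ∈ A, dist (s c) f ≤
      2 * ∑ c ∈ C with s c ∈ A, (dist c (s c) + dist c (o c)) := by
    rw [hfib, hfib, Finset.mul_sum]
    refine Finset.sum_le_sum fun g hg => le_trans (le_of_eq ?_) (hcap g hg)
    exact Finset.sum_congr rfl fun c hc => by rw [(Finset.mem_filter.1 hc).2]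
  simp only [Finset.card_singleton, Nat.cast_one, mul_one] at h1
  linarith

/-- The opening cost of the copies of `f` needed to close a set `M` of captured facilities in
chunks of size at most `m`. -/
lemma mul_chunk_count_le {lam D : ℝ} {C F S M : Finset X} {s o : X → X} {f : X} {m : ℕ}
    (hlam : 0 ≤ lam) (hS : IsLocalOptimum lam D C F S) (hs : IsServing C S s) (hf : f ∈ F)
    (hM : M ⊆ S) (hm : 3 ≤ m) (hmD : (m : ℝ) ≤ D)
    (hcap : ∀ g ∈ M, ∑ c ∈ C with s c = g, dist g f ≤
      2 * ∑ c ∈ C with s c = g, (dist c (s c) + dist c (o c))) :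
    lam * ((M.card / m : ℕ) : ℝ) ≤
      6 / m * ∑ c ∈ C with s c ∈ M, (dist c (s c) + dist c (o c)) := by
  obtain ⟨κ, hκ, hcard⟩ := exists_chunk_coloring M (m := m) (by omega)
  set u := M.card / m with hu
  set G := ∑ c ∈ C with s c ∈ M, (dist c (s c) + dist c (o c)) with hG
  have hG0 : 0 ≤ G := Finset.sum_nonneg fun c _ => add_nonneg dist_nonneg dist_nonneg
  have hm3 : (3 : ℝ) ≤ m := by exact_mod_cast hm
  have hchunk : ∀ i ∈ Finset.range (u + 1), lam * ((M.filter fun x => κ x = i).card : ℝ) ≤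
      lam + 2 * ∑ c ∈ C with s c ∈ M.filter (fun x => κ x = i),
        (dist c (s c) + dist c (o c)) := fun i _ =>
    mul_card_le_of_captured hlam hS hs hf ((Finset.filter_subset _ _).trans hM)
      (le_trans (by exact_mod_cast hcard i) hmD) (by linarith)
      fun g hg => hcap g (Finset.mem_filter.1 hg).1
  have hsum := Finset.sum_le_sum hchunk
  have hL : ∑ i ∈ Finset.range (u + 1), ((M.filter fun x => κ x = i).card : ℝ) = M.card := by
    rw [Finset.card_eq_sum_card_fiberwise (f := κ) (t := Finset.range (u + 1))
      fun x hx => by simpa using hκ x hx]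
    push_cast
    rfl
  have hR : ∑ i ∈ Finset.range (u + 1), ∑ c ∈ C with s c ∈ M.filter (fun x => κ x = i),
        (dist c (s c) + dist c (o c)) = G := by
    rw [hG]
    simp_rw [Finset.sum_filter]
    rw [Finset.sum_comm]
    refine Finset.sum_congr rfl fun c _ => ?_
    by_cases hc : s c ∈ M
    · simp [Finset.mem_filter, hc, Finset.sum_ite_eq, Nat.lt_succ_iff.1 (hκ _ hc)]
    · simp [Finset.mem_filter, hc]
  rw [← Finset.mul_sum, hL, Finset.sum_add_distrib, ← Finset.mul_sum, hR] at hsum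
  simp only [Finset.sum_const, Finset.card_range, nsmul_eq_mul, Nat.cast_add, Nat.cast_one]
    at hsum
  have hum : (u : ℝ) * m ≤ M.card := by exact_mod_cast Nat.div_mul_le_self M.card m
  rw [div_mul_eq_mul_div, le_div_iff₀ (by linarith)]
  -- For u ≥ 1, lam (u + 1) ≤ 2 lam u ≤ (2/3) lam u m because m ≥ 3. A third of lam u m is then at
  -- most 2 `G`, which gives the constant 6.
  rcases Nat.eq_zero_or_pos u with h0 | h0
  · rw [h0]; simp; linarith
  · have hu1 : (1 : ℝ) ≤ u := by exact_mod_cast h0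
    have h5 : lam * (u * m) ≤ lam * M.card := mul_le_mul_of_nonneg_left hum hlam
    have hlu : lam ≤ lam * u := le_mul_of_one_le_right hlam hu1
    have hlum : lam * u * 3 ≤ lam * u * m :=
      mul_le_mul_of_nonneg_left hm3 (mul_nonneg hlam (by linarith))
    linarith

/-! ### The swap family attached to a system of home sets. -/

/-- Sums over the clients of the optimal facilities in `T`, split according to `h`. -/
lemma sum_sum_filter_fiber {Y : Type*} [DecidableEq Y] (C R T : Finset Y) (o h : Y → Y) (w : Y → ℝ) :
    ∑ g ∈ R, ∑ c ∈ C with (o c ∈ T ∧ h (o c) = g), w c =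
      ∑ c ∈ C with (o c ∈ T ∧ h (o c) ∈ R), w c := by
  simp_rw [Finset.sum_filter]
  rw [Finset.sum_comm]
  refine Finset.sum_congr rfl fun c _ => ?_
  by_cases hc : o c ∈ T
  · simp [hc, Finset.sum_ite_eq]
  · simp [hc]

/-- Local search bound for a system of home sets `H f ⊆ S'` for `f ∈ OPT`: those of the heads
`f ∈ W` are disjoint and captured by `f`, the others are singletons. -/
theorem cost_le_of_homes {lam D : ℝ} {C F S O W : Finset X} {s o h : X → X} {H : X → Finset X}
    {e : X → ℝ} {m : ℕ}
    (hlam : 0 ≤ lam) (hS : IsLocalOptimum lam D C F S) (hO : IsSolution F O)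
    (hs : IsServing C S s) (ho : IsServing C O o)
    (hm : 1 ≤ m) (hmD : (W = ∅ ∧ (m : ℝ) ≤ D) ∨ (3 ≤ m ∧ 1 + (m : ℝ) * m ≤ D))
    (hWO : W ⊆ O) (hhH : ∀ f ∈ O, h f ∈ H f) (hHS : ∀ f ∈ O, H f ⊆ S)
    (hsingle : ∀ f ∈ O, f ∉ W → H f = {h f})
    (hWdisj : ∀ f ∈ W, ∀ g ∈ W, f ≠ g → Disjoint (H f) (H g))
    (hcap : ∀ f ∈ W, ∀ g ∈ H f, ∑ c ∈ C with s c = g, dist g f ≤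
      2 * ∑ c ∈ C with s c = g, (dist c (s c) + dist c (o c)))
    (he : ∀ c ∈ C, 0 ≤ e c)
    (hreroute : ∀ c ∈ C, s c ∉ H (o c) → dist c (h (o c)) ≤ dist c (s c) + e c ∨
      dist c (h (o c)) ≤ dist c (o c) + e c) :
    lam * S.card + ∑ c ∈ C, dist c (s c) ≤
      lam * O.card + ∑ c ∈ C, dist c (o c) + ∑ c ∈ C, e c
        + 7 / m * (∑ c ∈ C, dist c (s c) + ∑ c ∈ C, dist c (o c)) := by
  have hm0 : (1 : ℝ) ≤ m := by exact_mod_cast hm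
  have hmleD : (m : ℝ) ≤ D := by
    rcases hmD with h1 | h1
    · exact h1.2
    · nlinarith [h1.2]
  -- `Q g` must be opened whenever `g` is closed, so only the `g` in `cl` can be closed by a bounded
  -- swap. In `lgI`, never opening `Q g` loses at most `dQ g`, which is covered by the opening cost
  -- of all but one member of `Q g`; the remaining one pays for `g`. In `lgII`, the members of `Q g`
  -- are opened individually; together they form `T`.
  let Q : X → Finset X := fun g => (O \ W).filter fun f => h f = g
  let cl : Finset X := S.filter fun g => (Q g).card ≤ m
  let lg : Finset X := S.filter fun g => ¬ (Q g).card ≤ m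
  let dQ : X → ℝ := fun g => ∑ c ∈ C with (o c ∈ O \ W ∧ h (o c) = g), dist c (s c)
  let lgI : Finset X := lg.filter fun g => dQ g ≤ lam * ((Q g).card - 1)
  let lgII : Finset X := lg.filter fun g => ¬ dQ g ≤ lam * ((Q g).card - 1)
  let T : Finset X := (O \ W).filter fun f => h f ∈ lgII
  let M : X → Finset X := fun f => if f ∈ W then (H f).filter fun g => g ∈ cl else ∅
  have hMH : ∀ f, M f ⊆ H f := fun f => by
    simp only [M]; split_ifs
    · exact Finset.filter_subset _ _
    · exact Finset.empty_subset _
  have hMcl : ∀ f, M f ⊆ cl := fun f => by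
    simp only [M]; split_ifs
    · exact fun g hg => (Finset.mem_filter.1 hg).2
    · exact Finset.empty_subset _
  have hMW : ∀ f, f ∉ W → M f = ∅ := fun f hf => by simp only [M, if_neg hf]
  have hclS : cl ⊆ S := Finset.filter_subset _ _
  choose κ hκ hκc using fun f => exists_chunk_coloring (M f) (m := m) hm
  -- `I₁` holds one swap per head and chunk, and for each `f` in `T` one swap that closes nothing,
  -- as `M f` is empty. `I₂` closes the remaining closable facilities one at a time.
  let I₁ : Finset (Σ _ : X, ℕ) := (W ∪ T).sigma fun f => Finset.range ((M f).card / m + 1)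
  let I₂ : Finset X := cl \ W.biUnion H
  let I : Finset ((Σ _ : X, ℕ) ⊕ X) := I₁.disjSum I₂
  let A : (Σ _ : X, ℕ) ⊕ X → Finset X :=
    Sum.elim (fun p => (M p.1).filter fun x => κ p.1 x = p.2) fun g => {g}
  let B : (Σ _ : X, ℕ) ⊕ X → Finset X :=
    Sum.elim (fun p => insert p.1 (((M p.1).filter fun x => κ p.1 x = p.2).biUnion Q)) Q
  have hWTO : W ∪ T ⊆ O := Finset.union_subset hWO
    ((Finset.filter_subset _ _).trans Finset.sdiff_subset)
  have hQO : ∀ g, Q g ⊆ O := fun g => (Finset.filter_subset _ _).trans Finset.sdiff_subset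
  have hAcl : ∀ i ∈ I, A i ⊆ cl := by
    rintro (p | g) hi
    · exact (Finset.filter_subset _ _).trans (hMcl _)
    · rw [Finset.inr_mem_disjSum] at hi
      exact Finset.singleton_subset_iff.2 (Finset.mem_sdiff.1 hi).1
  have hQB : ∀ i, ∀ g ∈ A i, Q g ⊆ B i := by
    rintro (p | g) g' hg'
    · exact (Finset.subset_biUnion_of_mem Q hg').trans (Finset.subset_insert _ _)
    · rw [Finset.mem_singleton.1 hg']; exact subset_rfl
  have hBO : ∀ i ∈ I, B i ⊆ O := by
    rintro (p | g) hi
    · rw [Finset.inl_mem_disjSum, Finset.mem_sigma] at hi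
      exact Finset.insert_subset (hWTO hi.1) (Finset.biUnion_subset.2 fun g _ => hQO g)
    · exact hQO g
  have hAm : ∀ i ∈ I, (A i).card ≤ m := by
    rintro (p | g) _
    · exact hκc _ _
    · exact hm
  have hAD : ∀ i ∈ I, ((A i).card : ℝ) ≤ D := fun i hi =>
    le_trans (by exact_mod_cast hAm i hi) hmleD
  have hBcard : ∀ i ∈ I, (B i).card ≤
      Sum.elim (fun _ => 1) (fun _ => 0) i + ∑ g ∈ A i, (Q g).card := by
    rintro (p | g) hi
    · refine (Finset.card_insert_le _ _).trans ?_
      have := Finset.card_biUnion_le (s := (M p.1).filter fun x => κ p.1 x = p.2) (t := Q)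
      simp only [A, Sum.elim_inl]
      omega
    · simp [A, B]
  have hBD : ∀ i ∈ I, ((B i).card : ℝ) ≤ D := by
    rintro (p | g) hi
    · have h1 := hBcard _ hi
      have h2 : ∑ g ∈ A (Sum.inl p), (Q g).card ≤ (A (Sum.inl p)).card * m := by
        rw [← smul_eq_mul]
        exact Finset.sum_le_card_nsmul _ _ _ fun g hg =>
          (Finset.mem_filter.1 (hAcl _ hi hg)).2
      simp only [Sum.elim_inl] at h1
      -- Without heads, the swaps in `I₁` only open one facility. Otherwise up to m facilities
      -- close, each forcing at most m openings besides the head itself.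
      rcases hmD with ⟨hW, hmD⟩ | ⟨_, hmD⟩
      · have h3 : A (Sum.inl p) = ∅ := by
          simp [A, hMW p.1 (by simp [hW])]
        rw [h3] at h1
        simp only [Finset.sum_empty] at h1
        exact le_trans (le_trans (by exact_mod_cast h1) hm0) hmD
      · refine le_trans ?_ hmD
        have h4 := h1.trans (Nat.add_le_add_left (h2.trans
          (Nat.mul_le_mul_right m (hAm _ hi))) 1)
        exact_mod_cast h4
    · rw [Finset.inr_mem_disjSum] at hi
      refine le_trans ?_ hmleD
      exact_mod_cast (Finset.mem_filter.1 (Finset.mem_sdiff.1 hi).1).2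
  have hdisj : ∀ i ∈ I, ∀ j ∈ I, i ≠ j → Disjoint (A i) (A j) := by
    have hmix : ∀ p : (Σ _ : X, ℕ), ∀ g ∈ I₂, g ∉ A (Sum.inl p) := by
      intro p g hg hgA
      have hgM := (Finset.mem_filter.1 hgA).1
      by_cases hp : p.1 ∈ W
      · exact (Finset.mem_sdiff.1 hg).2 (Finset.mem_biUnion.2 ⟨p.1, hp, hMH _ hgM⟩)
      · rw [hMW _ hp] at hgM
        exact Finset.notMem_empty _ hgM
    rintro (p | g) hi (q | g') hj hij
    · rw [Finset.disjoint_left]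
      intro x hx hx'
      obtain ⟨hx1, hx2⟩ := Finset.mem_filter.1 hx
      obtain ⟨hx3, hx4⟩ := Finset.mem_filter.1 hx'
      have hp : p.1 ∈ W := by
        by_contra hp; rw [hMW _ hp] at hx1; exact Finset.notMem_empty _ hx1
      have hq : q.1 ∈ W := by
        by_contra hq; rw [hMW _ hq] at hx3; exact Finset.notMem_empty _ hx3
      by_cases hpq : p.1 = q.1
      · apply hij
        obtain ⟨p1, p2⟩ := p
        obtain ⟨q1, q2⟩ := q
        simp only at hpq hx2 hx4
        subst hpq
        rw [← hx2, ← hx4]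
      · exact Finset.disjoint_left.1 (hWdisj _ hp _ hq hpq) (hMH _ hx1) (hMH _ hx3)
    · rw [Finset.inr_mem_disjSum] at hj
      exact Finset.disjoint_singleton_right.2 (hmix p g' hj)
    · rw [Finset.inr_mem_disjSum] at hi
      exact Finset.disjoint_singleton_left.2 (hmix q g hi)
    · exact Finset.disjoint_singleton.2 fun hgg => hij (by rw [hgg])
  have hvalid : ∀ i ∈ I, ∀ f ∈ O, f ∉ B i → Disjoint (H f) (A i) := by
    intro i hi f hf hfB
    by_cases hfW : f ∈ W
    · rcases i with p | g
      · rw [Finset.inl_mem_disjSum, Finset.mem_sigma] at hi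
        by_cases hp : p.1 ∈ W
        · have hfp : f ≠ p.1 := fun hfp => hfB (hfp ▸ Finset.mem_insert_self _ _)
          exact (hWdisj f hfW _ hp hfp).mono_right ((Finset.filter_subset _ _).trans (hMH _))
        · have : A (Sum.inl p) = ∅ := by simp [A, hMW _ hp]
          rw [this]; exact Finset.disjoint_empty_right _
      · rw [Finset.inr_mem_disjSum] at hi
        exact Finset.disjoint_singleton_right.2 fun hg =>
          (Finset.mem_sdiff.1 hi).2 (Finset.mem_biUnion.2 ⟨f, hfW, hg⟩)
    · rw [hsingle f hf hfW]
      refine Finset.disjoint_singleton_left.2 fun hfA => hfB (hQB i _ hfA ?_)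
      exact Finset.mem_filter.2 ⟨Finset.mem_sdiff.2 ⟨hf, hfW⟩, rfl⟩
  have hmain := sum_swap_le hlam hS hO hs ho (fun i hi => (hAcl i hi).trans hclS) hBO hAD hBD
    hdisj hhH hHS hvalid he hreroute
  -- every closable facility is closed
  have hclA : cl ⊆ I.biUnion A := by
    intro g hg
    rw [Finset.mem_biUnion]
    by_cases hgW : g ∈ W.biUnion H
    · obtain ⟨f, hf, hgf⟩ := Finset.mem_biUnion.1 hgW
      have hgM : g ∈ M f := by simp only [M, if_pos hf]; exact Finset.mem_filter.2 ⟨hgf, hg⟩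
      refine ⟨Sum.inl ⟨f, κ f g⟩, ?_, Finset.mem_filter.2 ⟨hgM, rfl⟩⟩
      rw [Finset.inl_mem_disjSum, Finset.mem_sigma]
      exact ⟨Finset.mem_union_left _ hf, Finset.mem_range.2 (hκ f g hgM)⟩
    · exact ⟨Sum.inr g, Finset.inr_mem_disjSum.2 (Finset.mem_sdiff.2 ⟨hg, hgW⟩),
        Finset.mem_singleton_self g⟩
  have hAsum : (cl.card : ℝ) ≤ ∑ i ∈ I, ((A i).card : ℝ) := by
    exact_mod_cast (Finset.card_le_card hclA).trans Finset.card_biUnion_le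
  -- opened facilities
  have hBsum : ∑ i ∈ I, ((B i).card : ℝ) ≤ W.card + T.card
      + ∑ f ∈ W, (((M f).card / m : ℕ) : ℝ) + ∑ g ∈ cl, ((Q g).card : ℝ) := by
    have h1 : ∑ i ∈ I, (B i).card ≤
        ∑ i ∈ I, Sum.elim (fun _ => 1) (fun _ => 0) i + ∑ i ∈ I, ∑ g ∈ A i, (Q g).card := by
      rw [← Finset.sum_add_distrib]
      exact Finset.sum_le_sum hBcard
    have h2 : ∑ i ∈ I, ∑ g ∈ A i, (Q g).card ≤ ∑ g ∈ cl, (Q g).card := by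
      rw [← Finset.sum_biUnion fun i hi j hj hij => hdisj i hi j hj hij]
      exact Finset.sum_le_sum_of_subset (Finset.biUnion_subset.2 hAcl)
    have h3 : ∑ i ∈ I, Sum.elim (fun _ : (Σ _ : X, ℕ) => 1) (fun _ : X => 0) i =
        ∑ f ∈ W ∪ T, ((M f).card / m + 1) := by
      simp only [I, I₁, Finset.sum_disjSum, Sum.elim_inl, Sum.elim_inr, Finset.sum_const_zero,
        add_zero, Finset.sum_const, smul_eq_mul, mul_one, Finset.card_sigma, Finset.card_range]
    have h4 : Disjoint W T := by
      rw [Finset.disjoint_left]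
      intro f hf hfT
      exact (Finset.mem_sdiff.1 (Finset.mem_filter.1 hfT).1).2 hf
    have h5 : ∑ f ∈ T, ((M f).card / m + 1) = T.card := by
      rw [Finset.card_eq_sum_ones]
      refine Finset.sum_congr rfl fun f hf => ?_
      rw [hMW f (Finset.disjoint_right.1 h4 hf)]
      simp
    rw [h3, Finset.sum_union h4, h5, Finset.sum_add_distrib, ← Finset.card_eq_sum_ones] at h1
    have h6 : ∑ i ∈ I, (B i).card ≤ W.card + T.card
        + ∑ f ∈ W, (M f).card / m + ∑ g ∈ cl, (Q g).card := by omega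
    exact_mod_cast h6
  have hfibS : ∀ R : Finset X, ((O \ W).filter fun f => h f ∈ R).card = ∑ g ∈ R, (Q g).card := by
    intro R
    have hmaps : Set.MapsTo h (((O \ W).filter fun f => h f ∈ R : Finset X) : Set X) R :=
      fun f hf => (Finset.mem_filter.1 (Finset.mem_coe.1 hf)).2
    rw [Finset.card_eq_sum_card_fiberwise hmaps]
    refine Finset.sum_congr rfl fun g hg => ?_
    congr 1
    ext f
    simp only [Q, Finset.mem_filter]
    constructor
    · exact fun ⟨⟨h1, _⟩, h2⟩ => ⟨h1, h2⟩
    · exact fun ⟨h1, h2⟩ => ⟨⟨h1, h2 ▸ hg⟩, h2⟩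
  have hScard : (S.card : ℝ) = cl.card + (lgI.card + lgII.card) := by
    have h1 := Finset.card_filter_add_card_filter_not (s := S) fun g => (Q g).card ≤ m
    have h2 := Finset.card_filter_add_card_filter_not (s := lg)
      fun g => dQ g ≤ lam * ((Q g).card - 1)
    have h3 : cl.card + (lgI.card + lgII.card) = S.card := by
      rw [← h1]; exact congrArg _ h2
    exact_mod_cast h3.symm
  have hOcard : (O.card : ℝ) = W.card + (∑ g ∈ cl, ((Q g).card : ℝ)
      + (∑ g ∈ lgI, ((Q g).card : ℝ) + T.card)) := by
    have h1 := Finset.sum_filter_add_sum_filter_not S (fun g => (Q g).card ≤ m)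
      fun g => (Q g).card
    have h2 := Finset.sum_filter_add_sum_filter_not lg
      (fun g => dQ g ≤ lam * ((Q g).card - 1)) fun g => (Q g).card
    have h3 := hfibS S
    rw [Finset.filter_true_of_mem fun f hf =>
      hHS f (Finset.mem_sdiff.1 hf).1 (hhH f (Finset.mem_sdiff.1 hf).1)] at h3
    have h4 := Finset.card_sdiff_add_card_eq_card hWO
    have h5 : T.card = ∑ g ∈ lgII, (Q g).card := hfibS lgII
    have h6 : O.card = W.card + (∑ g ∈ cl, (Q g).card + (∑ g ∈ lgI, (Q g).card + T.card)) := by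
      rw [h5, ← h4, h3, ← h1, add_comm]
      congr 2
      exact h2.symm
    exact_mod_cast h6
  -- clients of facilities which are never opened
  have hunopened : ∑ c ∈ C, (if ∃ i ∈ I, o c ∈ B i then 0 else dist c (s c)) ≤
      ∑ g ∈ lgI, dQ g := by
    simp only [dQ]
    rw [sum_sum_filter_fiber, Finset.sum_filter]
    refine Finset.sum_le_sum fun c hc => ?_
    have hoc := (ho c hc).1
    split_ifs with h1 h2 h2
    · exact dist_nonneg
    · exact le_rfl
    · exact le_rfl
    · exfalso
      have hWT : o c ∈ W ∪ T → False := fun hmem => h1 ⟨Sum.inl ⟨o c, 0⟩,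
        Finset.inl_mem_disjSum.2 (Finset.mem_sigma.2 ⟨hmem, by simp⟩),
        Finset.mem_insert_self _ _⟩
      have hcW : o c ∈ O \ W :=
        Finset.mem_sdiff.2 ⟨hoc, fun hW => hWT (Finset.mem_union_left _ hW)⟩
      have hhS := hHS _ hoc (hhH _ hoc)
      by_cases h3 : (Q (h (o c))).card ≤ m
      · obtain ⟨i, hi, hiA⟩ := Finset.mem_biUnion.1 (hclA (Finset.mem_filter.2 ⟨hhS, h3⟩))
        exact h1 ⟨i, hi, hQB i _ hiA (Finset.mem_filter.2 ⟨hcW, rfl⟩)⟩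
      · have hlg : h (o c) ∈ lg := Finset.mem_filter.2 ⟨hhS, h3⟩
        by_cases h4 : dQ (h (o c)) ≤ lam * ((Q (h (o c))).card - 1)
        · exact h2 ⟨hcW, Finset.mem_filter.2 ⟨hlg, h4⟩⟩
        · exact hWT (Finset.mem_union_right _ (Finset.mem_filter.2
            ⟨hcW, Finset.mem_filter.2 ⟨hlg, h4⟩⟩))
  have hIsum : ∑ g ∈ lgI, dQ g ≤ lam * ∑ g ∈ lgI, ((Q g).card : ℝ) - lam * lgI.card := by
    have h1 : ∑ g ∈ lgI, dQ g ≤ ∑ g ∈ lgI, lam * (((Q g).card : ℝ) - 1) :=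
      Finset.sum_le_sum fun g hg => (Finset.mem_filter.1 hg).2
    rw [← Finset.mul_sum, Finset.sum_sub_distrib] at h1
    simp only [Finset.sum_const, nsmul_eq_mul, mul_one] at h1
    linarith
  -- Here |`Q g`| - 1 ≥ m, so `dQ g` exceeds lam m, and distinct `g` have disjoint sets of clients
  -- in `dQ`.
  have hIIsum : lam * lgII.card ≤ 1 / m * ∑ c ∈ C, dist c (s c) := by
    have h1 : ∀ g ∈ lgII, lam * m ≤ dQ g := by
      intro g hg
      obtain ⟨h2, h3⟩ := Finset.mem_filter.1 hg
      have h4 := (Finset.mem_filter.1 h2).2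
      have h5 : (m : ℝ) ≤ (Q g).card - 1 := by
        have : m + 1 ≤ (Q g).card := by omega
        have : (m : ℝ) + 1 ≤ (Q g).card := by exact_mod_cast this
        linarith
      exact (mul_le_mul_of_nonneg_left h5 hlam).trans (not_le.1 h3).le
    have h2 : ∑ g ∈ lgII, lam * m ≤ ∑ c ∈ C, dist c (s c) := by
      refine (Finset.sum_le_sum h1).trans ?_
      simp only [dQ]
      rw [sum_sum_filter_fiber]
      exact Finset.sum_le_sum_of_subset_of_nonneg (Finset.filter_subset _ _)
        fun _ _ _ => dist_nonneg
    rw [Finset.sum_const, nsmul_eq_mul] at h2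
    rw [div_mul_eq_mul_div, le_div_iff₀ (by linarith)]
    linarith
  have hextra : lam * ∑ f ∈ W, (((M f).card / m : ℕ) : ℝ) ≤
      6 / m * (∑ c ∈ C, dist c (s c) + ∑ c ∈ C, dist c (o c)) := by
    rcases hmD with ⟨hW, _⟩ | ⟨hm3, _⟩
    · rw [hW, Finset.sum_empty, mul_zero]
      exact mul_nonneg (by positivity) (add_nonneg
        (Finset.sum_nonneg fun _ _ => dist_nonneg) (Finset.sum_nonneg fun _ _ => dist_nonneg))
    · rw [Finset.mul_sum]
      calc ∑ f ∈ W, lam * (((M f).card / m : ℕ) : ℝ)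
          ≤ ∑ f ∈ W, 6 / m * ∑ c ∈ C with s c ∈ M f, (dist c (s c) + dist c (o c)) :=
            Finset.sum_le_sum fun f hf => mul_chunk_count_le hlam hS hs (hO.1 (hWO hf))
              ((hMcl f).trans hclS) hm3 hmleD fun g hg => hcap f hf g (hMH f hg)
        _ = 6 / m * ∑ f ∈ W, ∑ c ∈ C with s c ∈ M f, (dist c (s c) + dist c (o c)) :=
            (Finset.mul_sum _ _ _).symm
        _ ≤ _ := by
            refine mul_le_mul_of_nonneg_left ?_ (by positivity)
            rw [← Finset.sum_add_distrib, ← Finset.sum_biUnion]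
            · exact Finset.sum_le_sum_of_subset_of_nonneg
                (Finset.biUnion_subset.2 fun f _ => Finset.filter_subset _ _)
                fun _ _ _ => add_nonneg dist_nonneg dist_nonneg
            · intro f hf g hg hfg
              refine Finset.disjoint_left.2 fun c hc hc' => ?_
              exact Finset.disjoint_left.1 (hWdisj f hf g hg hfg)
                (hMH f (Finset.mem_filter.1 hc).2) (hMH g (Finset.mem_filter.1 hc').2)
  rw [Finset.sum_add_distrib, Finset.sum_add_distrib, Finset.sum_sub_distrib] at hmain
  have hA' := mul_le_mul_of_nonneg_left hAsum hlam
  have hB' := mul_le_mul_of_nonneg_left hBsum hlam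
  have hopt0 : 0 ≤ 1 / (m : ℝ) * ∑ c ∈ C, dist c (o c) :=
    mul_nonneg (by positivity) (Finset.sum_nonneg fun _ _ => dist_nonneg)
  have h7 : 7 / (m : ℝ) * (∑ c ∈ C, dist c (s c) + ∑ c ∈ C, dist c (o c)) =
      6 / m * (∑ c ∈ C, dist c (s c) + ∑ c ∈ C, dist c (o c))
        + 1 / m * ∑ c ∈ C, dist c (s c) + 1 / m * ∑ c ∈ C, dist c (o c) := by ring
  rw [hScard, hOcard, h7]
  linarith

/-! ### Capturing and the distances it controls. -/

lemma connCost_nonneg (C S : Finset X) : 0 ≤ connCost C S :=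
  Finset.sum_nonneg fun _ _ => Metric.infDist_nonneg

lemma IsServing.connCost_eq {C C' S : Finset X} {s : X → X} (hs : IsServing C S s)
    (hC : C' ⊆ C) : connCost C' S = ∑ c ∈ C', dist c (s c) :=
  Finset.sum_congr rfl fun c hc => (hs c (hC hc)).2.symm

lemma clientsOf_subset (C : Finset X) (s : X → X) (A : Finset X) : clientsOf C s A ⊆ C :=
  Finset.filter_subset _ _

lemma Captures.exists_client {C : Finset X} {α : ℝ} {s t : X → X} {A : Finset X} {g : X}
    (hα : 0 ≤ α) (h : Captures C α s A t g) : ∃ c ∈ C, s c ∈ A ∧ t c = g := by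
  have h1 : (0 : ℝ) < ((clientsOf C s A ∩ clientsOf C t {g}).card : ℝ) :=
    lt_of_le_of_lt (mul_nonneg hα (Nat.cast_nonneg _)) h
  obtain ⟨c, hc⟩ := Finset.card_pos.1 (by exact_mod_cast h1)
  simp only [clientsOf, Finset.mem_inter, Finset.mem_filter, Finset.mem_singleton] at hc
  exact ⟨c, hc.1.1, hc.1.2, hc.2.2⟩

/-- Only one facility can capture more than half of the clients of `g`. -/
lemma Captures.eq_of_half {C : Finset X} {s t : X → X} {f f' g : X}
    (h : Captures C (1 / 2) s {f} t g) (h' : Captures C (1 / 2) s {f'} t g) : f = f' := by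
  by_contra hne
  unfold Captures at h h'
  have hd : Disjoint (clientsOf C s {f} ∩ clientsOf C t {g})
      (clientsOf C s {f'} ∩ clientsOf C t {g}) := by
    rw [Finset.disjoint_left]
    intro c hc hc'
    simp only [clientsOf, Finset.mem_inter, Finset.mem_filter, Finset.mem_singleton] at hc hc'
    exact hne (hc.1.2.symm.trans hc'.1.2)
  have h1 := Finset.card_le_card (Finset.union_subset
    (Finset.inter_subset_right (s₁ := clientsOf C s {f}) (s₂ := clientsOf C t {g}))
    (Finset.inter_subset_right (s₁ := clientsOf C s {f'}) (s₂ := clientsOf C t {g})))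
  rw [Finset.card_union_of_disjoint hd] at h1
  have h2 : ((clientsOf C s {f} ∩ clientsOf C t {g}).card : ℝ)
      + (clientsOf C s {f'} ∩ clientsOf C t {g}).card ≤ (clientsOf C t {g}).card := by
    exact_mod_cast h1
  linarith

/-- If `f` captures `g`, then the clients of `g` can be moved from `g` to `f` cheaply. -/
lemma Captures.sum_dist_le {C : Finset X} {s o : X → X} {f g : X}
    (h : Captures C (1 / 2) o {f} s g) :
    ∑ c ∈ C with s c = g, dist g f ≤
      2 * ∑ c ∈ C with s c = g, (dist c (s c) + dist c (o c)) := by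
  unfold Captures at h
  set N := clientsOf C o {f} ∩ clientsOf C s {g} with hN
  have hG : clientsOf C s {g} = C.filter fun c => s c = g := by
    simp [clientsOf]
  have hNG : N ⊆ C.filter fun c => s c = g := hG ▸ Finset.inter_subset_right
  rw [hG] at h
  -- Each captured client links `g` to `f`. As these are more than half of the clients of `g`,
  -- averaging over them loses a factor 2.
  have h1 : ∑ c ∈ N, dist g f ≤ ∑ c ∈ N, (dist c (s c) + dist c (o c)) := by
    refine Finset.sum_le_sum fun c hc => ?_
    simp only [hN, clientsOf, Finset.mem_inter, Finset.mem_filter, Finset.mem_singleton] at hc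
    rw [hc.1.2, hc.2.2, dist_comm c g]
    exact dist_triangle g c f
  have h2 : ∑ c ∈ N, (dist c (s c) + dist c (o c)) ≤
      ∑ c ∈ C with s c = g, (dist c (s c) + dist c (o c)) :=
    Finset.sum_le_sum_of_subset_of_nonneg hNG
      fun _ _ _ => add_nonneg dist_nonneg dist_nonneg
  rw [Finset.sum_const, nsmul_eq_mul] at h1 ⊢
  have h3 := mul_le_mul_of_nonneg_right h.le (dist_nonneg (x := g) (y := f))
  linarith

/-- Rerouting the clients of `f` which are not captured by `A` through `f` to the facility `a ∈ A`
nearest to `f`. -/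
lemma Captures.sum_reroute_le {C A : Finset X} {δ : ℝ} {s o : X → X} {f a : X}
    (hδ : δ < 1) (h : Captures C (1 - δ) s A o f)
    (ha : ∀ g ∈ A, dist f a ≤ dist f g) :
    ∑ c ∈ C with (o c = f ∧ s c ∉ A), dist f a ≤
      δ / (1 - δ) * ∑ c ∈ C with (o c = f ∧ s c ∈ A), (dist c (s c) + dist c (o c)) := by
  unfold Captures at h
  set N := C.filter fun c => o c = f ∧ s c ∈ A with hN
  set N' := C.filter fun c => o c = f ∧ s c ∉ A with hN'
  have h1 : clientsOf C s A ∩ clientsOf C o {f} = N := by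
    ext c
    simp only [hN, clientsOf, Finset.mem_inter, Finset.mem_filter, Finset.mem_singleton]
    tauto
  have h2 : ((clientsOf C o {f}).card : ℝ) = N.card + N'.card := by
    have h3 := Finset.card_filter_add_card_filter_not (s := clientsOf C o {f}) fun c => s c ∈ A
    simp only [clientsOf, Finset.filter_filter, Finset.mem_singleton] at h3
    simp only [clientsOf, Finset.mem_singleton]
    exact_mod_cast h3.symm
  rw [h1, h2] at h
  have h4 : ∑ c ∈ N, dist f a ≤ ∑ c ∈ N, (dist c (s c) + dist c (o c)) := by
    refine Finset.sum_le_sum fun c hc => ?_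
    obtain ⟨_, hof, hsA⟩ := Finset.mem_filter.1 hc
    have h5 := ha _ hsA
    have h6 := dist_triangle f c (s c)
    rw [hof, dist_comm c f]
    linarith
  rw [Finset.sum_const, nsmul_eq_mul] at h4 ⊢
  have hδ' : 0 < 1 - δ := by linarith
  rw [div_mul_eq_mul_div, le_div_iff₀ hδ']
  have h7 : (N'.card : ℝ) * (1 - δ) ≤ δ * N.card := by linarith
  have hN0 : (0 : ℝ) ≤ N.card := Nat.cast_nonneg _
  have hN'0 : (0 : ℝ) ≤ N'.card := Nat.cast_nonneg _
  have hδ0 : 0 ≤ δ * N.card := le_trans (mul_nonneg hN'0 hδ'.le) h7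
  have h8 := mul_le_mul_of_nonneg_right h7 (dist_nonneg (x := f) (y := a))
  rcases le_or_gt 0 δ with hd | hd
  · have h9 := mul_le_mul_of_nonneg_left h4 hd
    linarith
  -- A negative `δ` would ask for a captured fraction above 1.
  · exfalso
    have : (N.card : ℝ) ≤ 0 := by
      by_contra hpos
      push Not at hpos
      linarith [mul_neg_of_neg_of_pos hd hpos]
    have h10 : 0 ≤ (1 - δ) * ((N.card : ℝ) + N'.card) :=
      mul_nonneg hδ'.le (add_nonneg hN0 hN'0)
    linarith

/-! ### From home sets to matched and lonely costs. -/

/-- The local search bound, for home sets that come from a matching: `Mo` and `Ms` are the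
matched facilities, and `h f` is the facility of `H f` nearest to `f`. -/
theorem cost_le_of_matching {lam D δ : ℝ} {C F S O W Mo Ms : Finset X} {s o h : X → X}
    {H : X → Finset X} {m : ℕ}
    (hlam : 0 ≤ lam) (hδ0 : 0 ≤ δ) (hδ : δ < 1)
    (hS : IsLocalOptimum lam D C F S) (hO : IsSolution F O)
    (hs : IsServing C S s) (ho : IsServing C O o)
    (hm : 1 ≤ m) (hmD : (W = ∅ ∧ (m : ℝ) ≤ D) ∨ (3 ≤ m ∧ 1 + (m : ℝ) * m ≤ D))
    (hWO : W ⊆ O) (hhH : ∀ f ∈ O, h f ∈ H f) (hHS : ∀ f ∈ O, H f ⊆ S)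
    (hsingle : ∀ f ∈ O, f ∉ W → H f = {h f})
    (hWdisj : ∀ f ∈ W, ∀ g ∈ W, f ≠ g → Disjoint (H f) (H g))
    (hcap : ∀ f ∈ W, ∀ g ∈ H f, Captures C (1 / 2) o {f} s g)
    (hMs : ∀ f ∈ Mo, H f ⊆ Ms) (hMo : ∀ f ∈ Mo, Captures C (1 - δ) s (H f) o f)
    (hnear : ∀ f ∈ Mo, ∀ g ∈ H f, dist f (h f) ≤ dist f g)
    (hlonely : ∀ f ∈ O, f ∉ Mo → ∀ g ∈ S, dist f (h f) ≤ dist f g) :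
    lam * S.card + connCost C S ≤
      lam * O.card + 3 * connCost (clientsOf C o (O \ Mo)) O + connCost (clientsOf C o Mo) O
        + δ / (1 - δ) *
          (connCost (clientsOf C s Ms ∩ clientsOf C o Mo) S
            + connCost (clientsOf C s Ms ∩ clientsOf C o Mo) O)
        + 7 / m * (connCost C S + connCost C O) := by
  have hsub : clientsOf C s Ms ∩ clientsOf C o Mo ⊆ C :=
    Finset.inter_subset_left.trans (clientsOf_subset _ _ _)
  rw [hs.connCost_eq subset_rfl, ho.connCost_eq subset_rfl, hs.connCost_eq hsub,
    ho.connCost_eq hsub, ho.connCost_eq (clientsOf_subset _ _ _),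
    ho.connCost_eq (clientsOf_subset _ _ _)]
  -- The matched detour is measured against `dist c (o c)`, the lonely one against `dist c (s c)`;
  -- these are the two alternatives for rerouting.
  let e : X → ℝ := fun c =>
    if o c ∈ Mo then (if s c ∈ H (o c) then 0 else dist (o c) (h (o c))) else 2 * dist c (o c)
  have hmain := cost_le_of_homes (e := e) hlam hS hO hs ho hm hmD hWO hhH hHS hsingle hWdisj
    (fun f hf g hg => (hcap f hf g hg).sum_dist_le)
    (fun c _ => by
      simp only [e]
      split_ifs
      · exact le_rfl
      · exact dist_nonneg
      · exact mul_nonneg zero_le_two dist_nonneg)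
    (fun c hc hsH => by
      have h1 := dist_triangle c (o c) (h (o c))
      simp only [e]
      split_ifs with h2
      · exact Or.inr h1
      · left
        have h3 := hlonely _ (ho c hc).1 h2 _ (hs c hc).1
        have h4 := dist_triangle (o c) c (s c)
        rw [dist_comm (o c) c] at h4
        linarith)
  have hL : clientsOf C o (O \ Mo) = C.filter fun c => o c ∉ Mo := by
    refine Finset.filter_congr fun c hc => ?_
    rw [Finset.mem_sdiff]
    exact ⟨fun h1 => h1.2, fun h1 => ⟨(ho c hc).1, h1⟩⟩
  have hopt := Finset.sum_filter_add_sum_filter_not C (fun c => o c ∈ Mo) fun c => dist c (o c)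
  have he := Finset.sum_filter_add_sum_filter_not C (fun c => o c ∈ Mo) e
  have heL : ∑ c ∈ C with o c ∉ Mo, e c = 2 * ∑ c ∈ C with o c ∉ Mo, dist c (o c) := by
    rw [Finset.mul_sum]
    exact Finset.sum_congr rfl fun c hc => by simp only [e, if_neg (Finset.mem_filter.1 hc).2]
  have heM : ∑ c ∈ C with o c ∈ Mo, e c ≤ δ / (1 - δ) *
      (∑ c ∈ clientsOf C s Ms ∩ clientsOf C o Mo, dist c (s c)
        + ∑ c ∈ clientsOf C s Ms ∩ clientsOf C o Mo, dist c (o c)) := by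
    have hsplit : ∑ c ∈ C with o c ∈ Mo, e c =
        ∑ f ∈ Mo, ∑ c ∈ C with (o c = f ∧ s c ∉ H f), dist f (h f) := by
      simp_rw [Finset.sum_filter]
      rw [Finset.sum_comm]
      refine Finset.sum_congr rfl fun c _ => ?_
      by_cases hc : o c ∈ Mo
      · rw [Finset.sum_eq_single_of_mem (o c) hc fun f _ hf =>
          if_neg fun h1 : o c = f ∧ s c ∉ H f => hf h1.1.symm]
        by_cases h2 : s c ∈ H (o c) <;> simp [e, hc, h2]
      · rw [if_neg hc, Finset.sum_eq_zero]
        exact fun f hf => if_neg fun h1 : o c = f ∧ s c ∉ H f => hc (h1.1 ▸ hf)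
    rw [hsplit, ← Finset.sum_add_distrib]
    refine (Finset.sum_le_sum fun f hf =>
      (hMo f hf).sum_reroute_le hδ (hnear f hf)).trans ?_
    rw [← Finset.mul_sum]
    refine mul_le_mul_of_nonneg_left ?_ (div_nonneg hδ0 (by linarith))
    rw [← Finset.sum_biUnion]
    · refine Finset.sum_le_sum_of_subset_of_nonneg ?_
        fun _ _ _ => add_nonneg dist_nonneg dist_nonneg
      refine Finset.biUnion_subset.2 fun f hf c hc => ?_
      obtain ⟨hcC, hof, hsH⟩ := Finset.mem_filter.1 hc
      exact Finset.mem_inter.2 ⟨Finset.mem_filter.2 ⟨hcC, hMs f hf hsH⟩,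
        Finset.mem_filter.2 ⟨hcC, by rw [hof]; exact hf⟩⟩
    · intro f _ g _ hfg
      refine Finset.disjoint_left.2 fun c hc hc' => hfg ?_
      exact (Finset.mem_filter.1 hc).2.1.symm.trans (Finset.mem_filter.1 hc').2.1
  rw [hL]
  simp only [clientsOf] at heM ⊢
  linarith

/-! ### Home sets for the actual matching. -/

lemma mem_capturedBy {C T : Finset X} {α : ℝ} {s t : X → X} {f g : X} :
    g ∈ capturedBy C α s t T f ↔ g ∈ T ∧ Captures C α s {f} t g := by
  simp only [capturedBy, Finset.mem_filter]

lemma mem_matchedHeads {C S T : Finset X} {α β : ℝ} {s t : X → X} {f : X} :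
    f ∈ matchedHeads C α β s S t T ↔
      f ∈ S ∧ Captures C β t (capturedBy C α s t T f) s f := by
  simp only [matchedHeads, Finset.mem_filter]

lemma exists_nearest {S : Finset X} (hS : S.Nonempty) :
    ∃ n : X → X, ∀ f, n f ∈ S ∧ ∀ g ∈ S, dist f (n f) ≤ dist f g := by
  choose n hn using fun f => Finset.exists_min_image S (dist f) hS
  exact ⟨n, hn⟩

/-- The bound for single swaps, in which all facilities count as lonely. -/
theorem cost_le_of_all_lonely {lam D : ℝ} {C F S O : Finset X} {s o : X → X}
    (hlam : 0 ≤ lam) (hS : IsLocalOptimum lam D C F S) (hO : IsSolution F O)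
    (hs : IsServing C S s) (ho : IsServing C O o) (hD : 1 ≤ D) :
    lam * S.card + connCost C S ≤
      lam * O.card + 3 * connCost C O + 7 * (connCost C S + connCost C O) := by
  obtain ⟨n, hn⟩ := exists_nearest hS.1.2
  have h := cost_le_of_matching (δ := 0) (W := ∅) (Mo := ∅) (Ms := ∅) (h := n)
    (H := fun f => {n f}) (m := 1) hlam le_rfl one_pos hS hO hs ho le_rfl
    (Or.inl ⟨rfl, by simpa using hD⟩) (Finset.empty_subset _)
    (fun f _ => Finset.mem_singleton_self _)
    (fun f _ => Finset.singleton_subset_iff.2 (hn f).1) (fun _ _ _ => rfl)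
    (by simp) (by simp) (by simp) (by simp) (by simp) (fun f _ _ g hg => (hn f).2 g hg)
  have h1 : clientsOf C o O = C := Finset.filter_true_of_mem fun c hc => (ho c hc).1
  have h2 : clientsOf C o (∅ : Finset X) = ∅ := by simp [clientsOf]
  rw [Finset.sdiff_empty, h1, h2] at h
  simpa [connCost] using h

/-- The bound for swaps of polynomial size, for the matching of the setting. -/
theorem cost_le_of_swap_size {lam D δ : ℝ} {C F S O : Finset X} {s o : X → X} {m : ℕ}
    (hlam : 0 ≤ lam) (hδ0 : 0 ≤ δ) (hδ : δ < 1)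
    (hS : IsLocalOptimum lam D C F S) (hO : IsSolution F O)
    (hs : IsServing C S s) (ho : IsServing C O o)
    (hm : 3 ≤ m) (hmD : 1 + (m : ℝ) * m ≤ D) :
    lam * S.card + connCost C S ≤
      lam * O.card + 3 * connCost (clientsOf C o (optLonely C δ S s O o)) O
        + connCost (clientsOf C o (optMatched C δ S s O o)) O
        + δ / (1 - δ) *
          (connCost (clientsOf C s (solMatched C δ S s O o)
              ∩ clientsOf C o (optMatched C δ S s O o)) S
            + connCost (clientsOf C s (solMatched C δ S s O o)
              ∩ clientsOf C o (optMatched C δ S s O o)) O)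
        + 7 / m * (connCost C S + connCost C O) := by
  classical
  obtain ⟨n, hn⟩ := exists_nearest hS.1.2
  unfold optLonely optMatched solMatched
  split_ifs with hk
  · set W := matchedHeads C (1 / 2) (1 - δ) o O s S with hW
    have hWmem : ∀ f ∈ W, f ∈ O ∧ Captures C (1 - δ) s (capturedBy C (1 / 2) o s S f) o f :=
      fun f hf => mem_matchedHeads.1 hf
    let H : X → Finset X := fun f => if f ∈ W then capturedBy C (1 / 2) o s S f else {n f}
    have hHW : ∀ f ∈ W, H f = capturedBy C (1 / 2) o s S f := fun f hf => if_pos hf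
    have hHn : ∀ f, f ∉ W → H f = {n f} := fun f hf => if_neg hf
    have hHne : ∀ f, (H f).Nonempty := fun f => by
      by_cases hf : f ∈ W
      -- The strict inequality in `Captures` provides a client, so M(f) is nonempty.
      · obtain ⟨c, _, hc, _⟩ := (hWmem f hf).2.exists_client (by linarith)
        rw [hHW f hf]
        exact ⟨_, hc⟩
      · rw [hHn f hf]
        exact Finset.singleton_nonempty _
    choose h hh hmin using fun f => Finset.exists_min_image (H f) (dist f) (hHne f)
    have hhn : ∀ f, f ∉ W → h f = n f := fun f hf => by
      have := hh f
      rwa [hHn f hf, Finset.mem_singleton] at this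
    have hcap : ∀ f ∈ W, ∀ g ∈ H f, Captures C (1 / 2) o {f} s g := fun f hf g hg => by
      rw [hHW f hf] at hg
      exact (mem_capturedBy.1 hg).2
    refine cost_le_of_matching (W := W) (H := H) (h := h) hlam hδ0 hδ hS hO hs ho (by omega)
      (Or.inr ⟨hm, hmD⟩) (fun f hf => (hWmem f hf).1) (fun f _ => hh f) (fun f _ => ?_)
      (fun f _ hf => by rw [hhn f hf, hHn f hf]) (fun f hf g hg hfg => ?_) hcap
      (fun f hf => ?_) (fun f hf => ?_) (fun f _ => hmin f) (fun f _ hf g hg => ?_)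
    · by_cases hf : f ∈ W
      · rw [hHW f hf]
        exact fun g hg => (mem_capturedBy.1 hg).1
      · rw [hHn f hf]
        exact Finset.singleton_subset_iff.2 (hn f).1
    · exact Finset.disjoint_left.2 fun x hx hx' =>
        hfg ((hcap f hf x hx).eq_of_half (hcap g hg x hx'))
    · rw [hHW f hf]
      exact Finset.subset_biUnion_of_mem (fun f => capturedBy C (1 / 2) o s S f) hf
    · rw [hHW f hf]
      exact (hWmem f hf).2
    · rw [hhn f hf]
      exact (hn f).2 g hg
  · set Mo := matchedTails C (1 - δ) (1 / 2) s S o O with hMo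
    -- Every home is now a single facility, possibly shared by several members of `OPT`, so there
    -- are no heads and `W = ∅`.
    have hex : ∀ f, ∃ a ∈ S, (f ∈ Mo → a ∈ matchedHeads C (1 - δ) (1 / 2) s S o O ∧
        Captures C (1 - δ) s {a} o f) ∧ (f ∉ Mo → a = n f) := by
      intro f
      by_cases hf : f ∈ Mo
      · obtain ⟨a, ha, hfa⟩ := Finset.mem_biUnion.1 hf
        exact ⟨a, (mem_matchedHeads.1 ha).1, fun _ => ⟨ha, (mem_capturedBy.1 hfa).2⟩,
          fun h1 => absurd hf h1⟩
      · exact ⟨n f, (hn f).1, fun h1 => absurd h1 hf, fun _ => rfl⟩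
    choose a haS ha hna using hex
    refine cost_le_of_matching (W := ∅) (H := fun f => {a f}) (h := a) hlam hδ0 hδ hS hO hs ho
      (by omega) (Or.inr ⟨hm, hmD⟩) (Finset.empty_subset _)
      (fun f _ => Finset.mem_singleton_self _)
      (fun f _ => Finset.singleton_subset_iff.2 (haS f)) (fun _ _ _ => rfl)
      (by simp) (by simp) (fun f hf => Finset.singleton_subset_iff.2 (ha f hf).1)
      (fun f hf => (ha f hf).2) (fun f _ g hg => by rw [Finset.mem_singleton.1 hg])
      (fun f _ hf g hg => ?_)
    rw [hna f hf]
    exact (hn f).2 g hg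

end LocalSearch

/-! ### Numerical bounds on Δ and the conclusion. -/

/-- For ε > 1 the power drops below 1, but 7 log ε ≤ ε^7 keeps it at least 1 - 2/7, and the factor 2
makes up for this. -/
lemma one_le_swap_bound {ε : ℝ} (hε : 1 / 2 ≤ ε) :
    1 ≤ 2 * ε ^ (-2 * ε ^ (-7 : ℝ)) := by
  have hε0 : 0 < ε := by linarith
  rcases le_or_gt ε 1 with h1 | h1
  · have : 1 ≤ ε ^ (-2 * ε ^ (-7 : ℝ)) := by
      apply Real.one_le_rpow_of_pos_of_le_one_of_nonpos hε0 h1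
      have := Real.rpow_nonneg hε0.le (-7)
      linarith
    linarith
  · rw [Real.rpow_def_of_pos hε0]
    have h2 : Real.log ε * ε ^ (-7 : ℝ) ≤ 1 / 7 := by
      have h3' : Real.log ε * 7 ≤ ε ^ (7 : ℝ) := by
        rw [Real.rpow_def_of_pos hε0]
        have := Real.add_one_le_exp (Real.log ε * 7)
        linarith
      have h4 : 0 < ε ^ (7 : ℝ) := Real.rpow_pos_of_pos hε0 _
      rw [Real.rpow_neg hε0.le, ← div_eq_mul_inv, div_le_iff₀ h4]
      linarith
    have h5 := Real.add_one_le_exp (Real.log ε * (-2 * ε ^ (-7 : ℝ)))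
    linarith

/-- The exponent is at most -5, and three of these five factors 1/ε contribute at least 8. -/
lemma sixteen_div_sq_le_swap_bound {ε : ℝ} (hε0 : 0 < ε) (hε : ε < 1 / 2) :
    16 * (1 / ε) ^ 2 ≤ 2 * ε ^ (-2 * ε ^ (-7 : ℝ)) := by
  have h1 : (5 / 2 : ℝ) ≤ ε ^ (-7 : ℝ) := by
    have h2 : ε ^ (-2 : ℝ) ≤ ε ^ (-7 : ℝ) :=
      Real.rpow_le_rpow_of_exponent_ge hε0 (by linarith) (by norm_num)
    have h3 : (4 : ℝ) ≤ ε ^ (-2 : ℝ) := by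
      rw [Real.rpow_neg hε0.le, le_inv_comm₀ (by norm_num) (Real.rpow_pos_of_pos hε0 _)]
      rw [Real.rpow_two]
      nlinarith
    linarith
  have h2 : ε ^ (-5 : ℝ) ≤ ε ^ (-2 * ε ^ (-7 : ℝ)) :=
    Real.rpow_le_rpow_of_exponent_ge hε0 (by linarith) (by linarith)
  have h3 : ε ^ (-5 : ℝ) = (1 / ε) ^ 5 := by
    rw [Real.rpow_neg hε0.le, one_div, inv_pow]
    norm_cast
  have h4 : 2 ≤ 1 / ε := by rw [le_div_iff₀ hε0]; linarith
  have h5 : (2 : ℝ) ^ 3 ≤ (1 / ε) ^ 3 := pow_le_pow_left₀ (by norm_num) h4 3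
  have h6 : (1 / ε) ^ 5 = (1 / ε) ^ 3 * (1 / ε) ^ 2 := by ring
  have h7 := mul_le_mul_of_nonneg_right h5 (sq_nonneg (1 / ε))
  rw [h3, h6] at h2
  linarith

end UFL

theorem mainTheorem4 :
    ∃ K : ℝ, 0 < K ∧
      ∀ (X : Type*) [PseudoMetricSpace X] [DecidableEq X] (C F : Finset X)
        (lam ε δ : ℝ), 0 ≤ lam → 0 < ε → 0 ≤ δ → δ ≤ 1 / 2 →
      ∀ (S' OPT : Finset X) (s o : X → X),
        UFL.IsLocalOptimum lam (2 * ε ^ (-2 * ε ^ (-7 : ℝ))) C F S' →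
        UFL.IsSolution F OPT →
        UFL.IsServing C S' s →
        UFL.IsServing C OPT o →
        lam * (S'.card : ℝ) + UFL.connCost C S' ≤
          lam * (OPT.card : ℝ)
            + 3 * UFL.connCost (UFL.clientsOf C o (UFL.optLonely C δ S' s OPT o)) OPT
            + UFL.connCost (UFL.clientsOf C o (UFL.optMatched C δ S' s OPT o)) OPT
            + δ / (1 - δ) *
                (UFL.connCost (UFL.clientsOf C s (UFL.solMatched C δ S' s OPT o)
                      ∩ UFL.clientsOf C o (UFL.optMatched C δ S' s OPT o)) S'
                  + UFL.connCost (UFL.clientsOf C s (UFL.solMatched C δ S' s OPT o)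
                      ∩ UFL.clientsOf C o (UFL.optMatched C δ S' s OPT o)) OPT)
            + K * (ε * (UFL.connCost C S' + UFL.connCost C OPT)) := by
  -- For ε ≥ 1/2, 20 ε ≥ 10 covers 3 opt + 7 (d' + opt). For smaller ε, 7/m ≤ 7 ε leaves room to
  -- spare.
  refine ⟨20, by norm_num, ?_⟩
  intro X _ _ C F lam ε δ hlam hε hδ0 hδ S' OPT s o hS hO hs ho
  have hcost := add_nonneg (UFL.connCost_nonneg C S') (UFL.connCost_nonneg C OPT)
  rcases lt_or_ge ε (1 / 2) with hlt | hge
  · set m := ⌈1 / ε⌉₊ with hm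
    have hinv : 2 < 1 / ε := by rw [lt_div_iff₀ hε]; linarith
    have hm1 : 1 / ε ≤ m := Nat.le_ceil _
    have hm2 : (m : ℝ) < 1 / ε + 1 := Nat.ceil_lt_add_one (by linarith)
    have hm3 : 3 ≤ m := by
      have : (2 : ℝ) < m := by linarith
      exact_mod_cast this
    have hD := UFL.sixteen_div_sq_le_swap_bound hε hlt
    have hmD : 1 + (m : ℝ) * m ≤ 2 * ε ^ (-2 * ε ^ (-7 : ℝ)) := by nlinarith
    have h := UFL.cost_le_of_swap_size hlam hδ0 (by linarith) hS hO hs ho hm3 hmD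
    have h7 : 7 / (m : ℝ) ≤ 20 * ε := by
      have hm0 : (0 : ℝ) < m := by linarith
      rw [div_le_iff₀ hm0]
      rw [div_le_iff₀ hε] at hm1
      linarith
    have h8 := mul_le_mul_of_nonneg_right h7 hcost
    linarith
  · have h := UFL.cost_le_of_all_lonely hlam hS hO hs ho (UFL.one_le_swap_bound hge)
    have h1 : 0 ≤ UFL.connCost (UFL.clientsOf C o (UFL.optLonely C δ S' s OPT o)) OPT :=
      UFL.connCost_nonneg _ _
    have h2 : 0 ≤ UFL.connCost (UFL.clientsOf C o (UFL.optMatched C δ S' s OPT o)) OPT :=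
      UFL.connCost_nonneg _ _
    have h3 := mul_nonneg (div_nonneg hδ0 (by linarith : (0 : ℝ) ≤ 1 - δ))
      (add_nonneg
        (UFL.connCost_nonneg (UFL.clientsOf C s (UFL.solMatched C δ S' s OPT o)
          ∩ UFL.clientsOf C o (UFL.optMatched C δ S' s OPT o)) S')
        (UFL.connCost_nonneg (UFL.clientsOf C s (UFL.solMatched C δ S' s OPT o)
          ∩ UFL.clientsOf C o (UFL.optMatched C δ S' s OPT o)) OPT))
    have h4 := mul_le_mul_of_nonneg_right hge hcost
    have h5 := UFL.connCost_nonneg C S'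
    linarith
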